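/- Small set chasing (metrical service systems): a player starts at a point $s_0$ of a metric space $(M,d)$. At each time $t=1,\dots,T$ a set $S_t\subseteq M$ with $1\le |S_t|\le k$ is revealed, and the player has to relocate to a point $s_t\in S_t$, paying $d(s_{t-1},s_t)$. A deterministic online algorithm for chasing sets of cardinality at most $k$ chooses, for every metric space and every starting point, $s_t$ as a function of $(M,d)$, $s_0$ and $S_1,\dots,S_t$ only (neither the later requests nor $T$ are known). It is $\rho$-competitive if, for all metric spaces $(M,d)$, all $s_0\in M$ and all finite request sequences $S_1,\dots,S_T$ as above, $$\sum_{t=1}^T d(s_{t-1},s_t)\le \rho\cdot\min\Big\{\sum_{t=1}^T d(x_{t-1},x_t)\;\Big|\;x_0=s_0,\ x_1\in S_1,\dots,x_T\in S_T\Big\}.$$ Define $D_1=1$ and $D_{k+1}=2D_k+\sqrt{8+8D_k}+3$ for $k\ge 1$. Theorem. For every integer $k\ge 1$, every deterministic online algorithm for chasing sets of cardinality at most $k$ has competitive ratio at least $D_k$; that is, if the algorithm is $\rho$-competitive for a real number $\rho$, then $\rho\ge D_k$. -/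

import Mathlib

universe u

namespace SmallSetChasing

/-- A request sequence `S₁, …, S_T` (as a list) is admissible for the parameter `k` if every
request satisfies `1 ≤ |S_t| ≤ k`. -/
def IsRequestSeq {M : Type u} (k : ℕ) (σ : List (Finset M)) : Prop :=
  ∀ S ∈ σ, 1 ≤ S.card ∧ S.card ≤ k

/-- A deterministic online algorithm for chasing sets of cardinality at most `k` in metric spaces.
`pos s₀ [S₁, …, S_t]` is the position `s_t` of the player, started at `s₀`, right after it has
served the requests `S₁, …, S_t`. It is a function of what is known at time `t`: the metric space,
the initial point and the requests `S₁, …, S_t`, but neither later requests nor their number. -/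
structure OnlineAlgorithm (k : ℕ) where
  pos : ∀ {M : Type u} [MetricSpace M], M → List (Finset M) → M
  pos_nil : ∀ {M : Type u} [MetricSpace M] (s₀ : M), pos s₀ [] = s₀
  pos_mem : ∀ {M : Type u} [MetricSpace M] (s₀ : M) (σ : List (Finset M)) (S : Finset M),
    IsRequestSeq k (σ ++ [S]) → pos s₀ (σ ++ [S]) ∈ S

/-- The total cost `∑_{t=1}^T d(s_{t-1}, s_t)` of the algorithm on `σ = [S₁, …, S_T]`. -/
noncomputable def OnlineAlgorithm.cost {k : ℕ} (A : OnlineAlgorithm.{u} k)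
    {M : Type u} [MetricSpace M] (s₀ : M) (σ : List (Finset M)) : ℝ :=
  ∑ t ∈ Finset.range σ.length, dist (A.pos s₀ (σ.take t)) (A.pos s₀ (σ.take (t + 1)))

/-- The costs of all offline solutions: `∑_{t=1}^T d(x_{t-1}, x_t)` with `x₀ = s₀` and `x_t ∈ S_t`
for `1 ≤ t ≤ T`. The list index starts at `0`, so `S_{t+1}` is `σ[t]`; the values of `x` beyond
`T` play no role. -/
def offlineCosts {M : Type u} [MetricSpace M] (s₀ : M) (σ : List (Finset M)) : Set ℝ :=
  {c | ∃ x : ℕ → M, x 0 = s₀ ∧ (∀ (t : ℕ) (ht : t < σ.length), x (t + 1) ∈ σ[t]) ∧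
    c = ∑ t ∈ Finset.range σ.length, dist (x t) (x (t + 1))}

/-- The offline optimum, the least element of `offlineCosts` (see `isLeast_offlineOpt`). -/
noncomputable def offlineOpt {M : Type u} [MetricSpace M] (s₀ : M) (σ : List (Finset M)) : ℝ :=
  sInf (offlineCosts s₀ σ)

theorem offlineCosts_finite {M : Type u} [MetricSpace M] (s₀ : M) (σ : List (Finset M)) :
    (offlineCosts s₀ σ).Finite := by
  classical
  have hfin : (Set.univ.pi fun t : Fin σ.length => (σ[t] : Set M)).Finite :=
    Set.Finite.pi fun t => Finset.finite_toSet _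
  refine (hfin.image fun y : Fin σ.length → M =>
    ∑ t ∈ Finset.range σ.length,
      dist ((fun n : ℕ => if h : n - 1 < σ.length ∧ n ≠ 0 then y ⟨n - 1, h.1⟩ else s₀) t)
        ((fun n : ℕ => if h : n - 1 < σ.length ∧ n ≠ 0 then y ⟨n - 1, h.1⟩ else s₀)
          (t + 1))).subset ?_
  rintro c ⟨x, h0, hx, rfl⟩
  refine ⟨fun t => x (t + 1), fun t _ => hx t t.2, ?_⟩
  refine Finset.sum_congr rfl fun t ht => ?_
  have ht' : t < σ.length := Finset.mem_range.1 ht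
  rcases t with _ | t
  · simp [h0, ht']
  · have h2 : t < σ.length := by omega
    simp [ht', h2]

/-- The minimum that defines the offline optimum is attained. -/
theorem isLeast_offlineOpt {M : Type u} [MetricSpace M] {k : ℕ} (s₀ : M) (σ : List (Finset M))
    (hσ : IsRequestSeq k σ) : IsLeast (offlineCosts s₀ σ) (offlineOpt s₀ σ) := by
  classical
  have hne : ∀ (t : ℕ) (ht : t < σ.length), (σ[t]).Nonempty := fun t ht =>
    Finset.card_pos.1 (hσ _ (List.getElem_mem ht)).1
  have h : (offlineCosts s₀ σ).Nonempty := by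
    refine ⟨_, fun n => if h : n - 1 < σ.length ∧ n ≠ 0 then (hne (n - 1) h.1).choose else s₀,
      by simp, fun t ht => ?_, rfl⟩
    simpa [ht] using (hne t ht).choose_spec
  exact ⟨h.csInf_mem (offlineCosts_finite s₀ σ),
    fun c hc => csInf_le (offlineCosts_finite s₀ σ).bddBelow hc⟩

/-- `A` is `ρ`-competitive if, in every metric space, from every initial point and on every
admissible finite request sequence, its cost is at most `ρ` times the offline optimum. -/
def OnlineAlgorithm.IsCompetitive {k : ℕ} (A : OnlineAlgorithm.{u} k) (ρ : ℝ) : Prop :=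
  ∀ (M : Type u) [MetricSpace M] (s₀ : M) (σ : List (Finset M)),
    IsRequestSeq k σ → A.cost s₀ σ ≤ ρ * offlineOpt s₀ σ

/-- The sequence `D₁ = 1`, `D_{k+1} = 2 D_k + √(8 + 8 D_k) + 3` for `k ≥ 1`. The value at `0` is
a placeholder that is never used. -/
noncomputable def D : ℕ → ℝ
  | 0 => 0
  | 1 => 1
  | k + 2 => 2 * D (k + 1) + Real.sqrt (8 + 8 * D (k + 1)) + 3

end SmallSetChasing

/-! The proof is an induction on `k`: an adversary forcing a ratio `d` with `k` points yields one
forcing any `ρ < 2 * d + 3 + √(8 + 8 * d)` with `k + 1`. Two branches leave the current position.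
The old adversary plays at the end of the algorithm's branch, with the other end `b` added to each
request. The algorithm either deepens its branch at ratio `d`, or crosses over and pays both depths,
`x + y`. Requesting `{b}` alone cuts its branch off, which wins once `(ρ - d - 1) * y ≤ Z + (d + 1)
* x`, where `Z` is the excess of the cost over `d * (x + y)`. So the algorithm has to cross early.

Put `u = Z / y + 1`. Up to bounded errors in depth, a crossing at depth `x` turns `u` into `u * y /
x + 2`, a gain of at least `(u² - (ρ - 2d + 1)u + 2(ρ - d)) / (ρ - d - u)`. The numerator has
discriminant `(ρ - 2d - 3)² - (8 + 8d)`, negative in the relevant range of `ρ`. Hence `u` grows by a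
fixed amount per crossing, while `u ≥ ρ - d` already wins. `Reached.step` and `Reached.forces` give
the rules of this search, and `late_turn_bound` gives the growth. -/

namespace SmallSetChasing

/-! ### Offline paths -/

/-- `OfflineReach p τ q c`: starting in `p`, the requests `τ` can be served by a path of cost `c`
that ends in `q`. -/
inductive OfflineReach {M : Type u} [MetricSpace M] : M → List (Finset M) → M → ℝ → Prop
  | nil (p : M) : OfflineReach p [] p 0
  | cons {p s q : M} {S : Finset M} {τ : List (Finset M)} {c : ℝ} (hs : s ∈ S)
      (h : OfflineReach s τ q c) : OfflineReach p (S :: τ) q (dist p s + c)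

namespace OfflineReach

variable {M : Type u} [MetricSpace M]

theorem append {p q r : M} {τ υ : List (Finset M)} {c d : ℝ} (h : OfflineReach p τ q c)
    (h' : OfflineReach q υ r d) : OfflineReach p (τ ++ υ) r (c + d) := by
  induction h with
  | nil p => simpa using h'
  | cons hs _ ih =>
    rw [add_assoc]
    exact cons hs (ih h')

theorem single {p q : M} {S : Finset M} (hq : q ∈ S) : OfflineReach p [S] q (dist p q) := by
  simpa using cons (p := p) hq (nil q)

theorem map_mono {p q : M} {τ : List (Finset M)} {c : ℝ} (h : OfflineReach p τ q c)
    (f : Finset M → Finset M) (hf : ∀ S, S ⊆ f S) : OfflineReach p (τ.map f) q c := by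
  induction h with
  | nil p => exact nil p
  | cons hs _ ih => exact cons (hf _ hs) ih

theorem stay {p : M} {τ : List (Finset M)} (h : ∀ S ∈ τ, p ∈ S) : OfflineReach p τ p 0 := by
  induction τ with
  | nil => exact nil p
  | cons S τ ih =>
    simpa using cons (p := p) (h S (by simp)) (ih fun S hS => h S (by simp [hS]))

theorem mem_offlineCosts {p q : M} {τ : List (Finset M)} {c : ℝ} (h : OfflineReach p τ q c) :
    c ∈ offlineCosts p τ := by
  induction h with
  | nil p => exact ⟨fun _ => p, rfl, by simp, by simp⟩
  | @cons p s q S τ c hs _ ih =>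
    obtain ⟨x, h0, hx, rfl⟩ := ih
    refine ⟨fun n => Nat.casesOn n p x, rfl, ?_, ?_⟩
    · rintro (_ | t) ht
      · simpa [h0] using hs
      · simpa using hx t (by simpa using ht)
    · rw [List.length_cons, Finset.sum_range_succ']
      simp [h0, add_comm]

theorem offlineOpt_le {p q : M} {τ : List (Finset M)} {c : ℝ} (h : OfflineReach p τ q c) :
    offlineOpt p τ ≤ c :=
  csInf_le (offlineCosts_finite p τ).bddBelow h.mem_offlineCosts

end OfflineReach

/-! ### Online costs -/

theorem isRequestSeq_append_map_union {M : Type u} [DecidableEq M] {k K : ℕ}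
    {σ τ : List (Finset M)} {E : Finset M}
    (hσ : IsRequestSeq K σ) (hτ : IsRequestSeq k τ) (hE : k + E.card ≤ K) :
    IsRequestSeq K (σ ++ τ.map (· ∪ E)) := by
  intro S hS
  rcases List.mem_append.1 hS with hS | hS
  · exact hσ S hS
  · obtain ⟨R, hR, rfl⟩ := List.mem_map.1 hS
    have h1 := hτ R hR
    have h2 := Finset.card_union_le R E
    have h3 := Finset.card_le_card (Finset.subset_union_left (s₁ := R) (s₂ := E))
    omega

section Online

variable {M : Type u} [MetricSpace M] {K : ℕ} (A : OnlineAlgorithm.{u} K) (s₀ : M)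

theorem cost_append_singleton (σ : List (Finset M)) (S : Finset M) :
    A.cost s₀ (σ ++ [S]) = A.cost s₀ σ + dist (A.pos s₀ σ) (A.pos s₀ (σ ++ [S])) := by
  unfold OnlineAlgorithm.cost
  rw [List.length_append, List.length_singleton, Finset.sum_range_succ]
  congr 1
  · refine Finset.sum_congr rfl fun t ht => ?_
    have ht' := Finset.mem_range.1 ht
    rw [List.take_append_of_le_length ht'.le, List.take_append_of_le_length ht']
  · rw [List.take_append_of_le_length le_rfl, List.take_length,
      List.take_of_length_le (by simp)]

theorem dist_le_cost (σ τ : List (Finset M)) :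
    A.cost s₀ σ + dist (A.pos s₀ σ) (A.pos s₀ (σ ++ τ)) ≤ A.cost s₀ (σ ++ τ) := by
  induction τ using List.reverseRecOn with
  | nil => simp
  | append_singleton τ S ih =>
    rw [← List.append_assoc, cost_append_singleton]
    linarith [dist_triangle (A.pos s₀ σ) (A.pos s₀ (σ ++ τ)) (A.pos s₀ (σ ++ τ ++ [S]))]

variable [DecidableEq M]

theorem pos_mem_union {k : ℕ} {σ τ : List (Finset M)} {E S : Finset M}
    (hσ : IsRequestSeq K σ) (hτ : IsRequestSeq k (τ ++ [S])) (hE : k + E.card ≤ K) :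
    A.pos s₀ (σ ++ (τ ++ [S]).map (· ∪ E)) ∈ S ∪ E := by
  have h := isRequestSeq_append_map_union hσ hτ hE
  rw [List.map_append, List.map_singleton, ← List.append_assoc] at h ⊢
  exact A.pos_mem s₀ _ _ h

/-- From the history `σ` on, there are requests of cardinality at most `k` that, padded by the
points of `E`, either drive the algorithm into `E`, or make it end in a point `q` after having paid
`ρ` times the distance of `q`. The offline player can follow a shortest path to `q` in both cases;
`q` has distance at most `B`, and every point of `F` is reached from `q` through the old
position of the algorithm. -/
def Forces (k : ℕ) (ρ B : ℝ) (σ : List (Finset M)) (E F : Finset M) : Prop :=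
  ∃ (τ : List (Finset M)) (q : M), IsRequestSeq k τ ∧
    OfflineReach (A.pos s₀ σ) τ q (dist q (A.pos s₀ σ)) ∧
    (∀ z ∈ F, dist q z = dist q (A.pos s₀ σ) + dist (A.pos s₀ σ) z) ∧
    dist q (A.pos s₀ σ) ≤ B ∧
    (A.pos s₀ (σ ++ τ.map (· ∪ E)) ∈ E ∨
      A.pos s₀ (σ ++ τ.map (· ∪ E)) = q ∧ 1 ≤ dist q (A.pos s₀ σ) ∧
        A.cost s₀ σ + ρ * dist q (A.pos s₀ σ) ≤ A.cost s₀ (σ ++ τ.map (· ∪ E)))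

end Online

/-- Away from any finite set of points, one can move to a new point in a free direction. -/
def HasFreeDirections (M : Type u) [MetricSpace M] : Prop :=
  ∀ (F : Finset M) (p : M) (L : ℝ), 0 ≤ L → ∃ q, ∀ z ∈ F, dist q z = L + dist p z

/-- The adversary can force the ratio `ρ` with requests of cardinality at most `k`. -/
def IsForced (k : ℕ) (ρ : ℝ) : Prop :=
  ∃ B : ℝ, ∀ (K : ℕ) (A : OnlineAlgorithm.{u} K) (M : Type u) [MetricSpace M] [DecidableEq M],
    HasFreeDirections M → ∀ (s₀ : M) (σ : List (Finset M)) (E F : Finset M),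
      IsRequestSeq K σ → k + E.card ≤ K → A.pos s₀ σ ∈ F → Forces A s₀ k ρ B σ E F

theorem IsForced.mono {k : ℕ} {ρ ρ' : ℝ} (h : IsForced.{u} k ρ) (hρ : ρ' ≤ ρ) :
    IsForced.{u} k ρ' := by
  obtain ⟨B, hB⟩ := h
  refine ⟨B, fun K A M _ _ hM s₀ σ E F hσ hE hF => ?_⟩
  obtain ⟨τ, q, h1, h2, h3, h4, h5⟩ := hB K A M hM s₀ σ E F hσ hE hF
  refine ⟨τ, q, h1, h2, h3, h4, h5.imp id fun h => ⟨h.1, h.2.1, le_trans ?_ h.2.2⟩⟩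
  gcongr

theorem isForced_one : IsForced.{u} 1 1 := by
  refine ⟨1, fun K A M _ _ hM s₀ σ E F hσ hE hF => ?_⟩
  obtain ⟨q, hq⟩ := hM F (A.pos s₀ σ) 1 zero_le_one
  have hd : dist q (A.pos s₀ σ) = 1 := by simpa using hq _ hF
  have hτ : IsRequestSeq 1 [({q} : Finset M)] := by simp [IsRequestSeq]
  refine ⟨[{q}], q, hτ, ?_, by rwa [hd], hd.le, ?_⟩
  · rw [dist_comm]
    exact .single (by simp)
  · have h := pos_mem_union A s₀ (τ := []) hσ hτ hE
    rw [List.nil_append] at h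
    rcases Finset.mem_union.1 h with h | h
    · rw [Finset.mem_singleton] at h
      refine Or.inr ⟨h, hd.ge, ?_⟩
      have := dist_le_cost A s₀ σ ([{q}].map (· ∪ E))
      rw [h, dist_comm, hd] at this
      rw [hd]
      linarith
    · exact Or.inl h

/-! ### Two branches -/

section Branches

variable {M : Type u} [MetricSpace M] [DecidableEq M] {K : ℕ} (A : OnlineAlgorithm.{u} K) (s₀ : M)

/-- After the history `σ` and the requests `τ` (padded by `E`), the algorithm is in the end point
`a` of one of two branches that start in its position after `σ` and have the end points `a`, `b`
at depths `x`, `y`. -/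
structure Branching (k : ℕ) (σ : List (Finset M)) (E F : Finset M) (τ : List (Finset M))
    (a b : M) (x y : ℝ) : Prop where
  req : IsRequestSeq k τ
  pos_eq : A.pos s₀ (σ ++ τ.map (· ∪ E)) = a
  dist_left : ∀ z ∈ F, dist a z = x + dist (A.pos s₀ σ) z
  dist_right : ∀ z ∈ F, dist b z = y + dist (A.pos s₀ σ) z
  dist_eq : dist a b = x + y
  reach_left : OfflineReach (A.pos s₀ σ) τ a x
  reach_right : OfflineReach (A.pos s₀ σ) τ b y

/-- Two branches of depths `x`, `y` have been reached, and the cost of the algorithm exceeds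
`d * (x + y)` by at least `Z`. -/
def Reached (k : ℕ) (σ : List (Finset M)) (E F : Finset M) (d Z x y : ℝ) : Prop :=
  ∃ (τ : List (Finset M)) (a b : M), Branching A s₀ k σ E F τ a b x y ∧
    A.cost s₀ σ + Z + d * (x + y) ≤ A.cost s₀ (σ ++ τ.map (· ∪ E))

variable {A s₀} {k : ℕ} {σ : List (Finset M)} {E F : Finset M}

/-- The request `{a, b}` opens the branches. One move of length `L` is measured against `d * (L +
L)`, so the initial excess may be negative. -/
theorem forces_or_reached_init (hM : HasFreeDirections M) (hσ : IsRequestSeq K σ) (hk : 2 ≤ k)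
    (hE : k + E.card ≤ K) (hF : A.pos s₀ σ ∈ F) {L : ℝ} (hL : 0 ≤ L) {B : ℝ} (hB : L ≤ B)
    (d ρ : ℝ) : Forces A s₀ k ρ B σ E F ∨ Reached A s₀ k σ E F d (L - 2 * d * L) L L := by
  obtain ⟨a, ha⟩ := hM F (A.pos s₀ σ) L hL
  -- Including `a` makes the second branch leave the first one at the root.
  obtain ⟨b, hb⟩ := hM (insert a F) (A.pos s₀ σ) L hL
  have hap : dist a (A.pos s₀ σ) = L := by simpa using ha _ hF
  have hbp : dist b (A.pos s₀ σ) = L := by simpa using hb _ (Finset.mem_insert_of_mem hF)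
  have hab : dist a b = L + L := by
    rw [dist_comm, hb a (Finset.mem_insert_self _ _), dist_comm, hap]
  have hb' : ∀ z ∈ F, dist b z = L + dist (A.pos s₀ σ) z := fun z hz =>
    hb z (Finset.mem_insert_of_mem hz)
  have hτ : IsRequestSeq k [({a, b} : Finset M)] := by
    have h1 : 0 < ({a, b} : Finset M).card := Finset.card_pos.2 ⟨a, by simp⟩
    have h2 : ({a, b} : Finset M).card ≤ 2 := Finset.card_le_two
    intro S hS
    rw [List.mem_singleton.1 hS]
    omega
  have hra : OfflineReach (A.pos s₀ σ) [({a, b} : Finset M)] a L := by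
    rw [← hap, dist_comm]
    exact .single (by simp)
  have hrb : OfflineReach (A.pos s₀ σ) [({a, b} : Finset M)] b L := by
    rw [← hbp, dist_comm]
    exact .single (by simp)
  have h := pos_mem_union A s₀ (τ := []) hσ hτ hE
  have hc := dist_le_cost A s₀ σ ([{a, b}].map (· ∪ E))
  rw [List.nil_append] at h
  rcases Finset.mem_union.1 h with h | h
  · right
    rcases Finset.mem_insert.1 h with h | h
    · refine ⟨_, a, b, ⟨hτ, h, ha, hb', hab, hra, hrb⟩, ?_⟩
      rw [h, dist_comm, hap] at hc
      linarith
    · rw [Finset.mem_singleton] at h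
      refine ⟨_, b, a, ⟨hτ, h, hb', ha, by rw [dist_comm, hab], hrb, hra⟩, ?_⟩
      rw [h, dist_comm, hbp] at hc
      linarith
  · exact Or.inl ⟨_, a, hτ, by rwa [hap], by rwa [hap], hap.trans_le hB, Or.inl h⟩

/-- The branch of the algorithm can be cut off as soon as this is worth while. -/
theorem Reached.forces (hσ : IsRequestSeq K σ) (hk : 1 ≤ k) (hE : k + E.card ≤ K)
    (hF : A.pos s₀ σ ∈ F) {d Z x y ρ B : ℝ} (h : Reached A s₀ k σ E F d Z x y)
    (hZ : (ρ - d - 1) * y ≤ Z + (d + 1) * x) (hy : 1 ≤ y) (hB : y ≤ B) :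
    Forces A s₀ k ρ B σ E F := by
  obtain ⟨τ, a, b, h, hc⟩ := h
  have hbp : dist b (A.pos s₀ σ) = y := by simpa using h.dist_right _ hF
  have hτ : IsRequestSeq k (τ ++ [{b}]) := by
    intro S hS
    rcases List.mem_append.1 hS with hS | hS
    · exact h.req S hS
    · rw [List.mem_singleton.1 hS, Finset.card_singleton]
      exact ⟨le_rfl, hk⟩
  refine ⟨τ ++ [{b}], b, hτ, ?_, by simpa [hbp] using h.dist_right, hbp.trans_le hB, ?_⟩
  · rw [hbp]
    simpa using h.reach_right.append (.single (Finset.mem_singleton_self b))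
  · rcases Finset.mem_union.1 (pos_mem_union A s₀ hσ hτ hE) with h' | h'
    · right
      rw [Finset.mem_singleton] at h'
      refine ⟨h', hbp ▸ hy, ?_⟩
      have hc' := dist_le_cost A s₀ (σ ++ τ.map (· ∪ E)) ([{b}].map (· ∪ E))
      rw [List.append_assoc, ← List.map_append, h', h.pos_eq, h.dist_eq] at hc'
      rw [hbp]
      linarith
    · exact Or.inl h'

/-- One round: the adversary plays with requests of cardinality at most `k` at the end of the branch
of the algorithm, until the algorithm has moved on along this branch or goes to the other one. -/
theorem Reached.step {d B : ℝ}
    (hB : ∀ (σ : List (Finset M)) (E F : Finset M), IsRequestSeq K σ → k + E.card ≤ K →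
      A.pos s₀ σ ∈ F → Forces A s₀ k d B σ E F)
    (hσ : IsRequestSeq K σ) (hE : k + 1 + E.card ≤ K)
    (hF : A.pos s₀ σ ∈ F) {Z x y ρ B' : ℝ} (h : Reached A s₀ (k + 1) σ E F d Z x y)
    (hy : y ≤ B') :
    Forces A s₀ (k + 1) ρ B' σ E F ∨
      (∃ δ, 1 ≤ δ ∧ Reached A s₀ (k + 1) σ E F d Z (x + δ) y) ∨
      ∃ δ, 0 ≤ δ ∧ δ ≤ B ∧ Reached A s₀ (k + 1) σ E F d (Z + x + y - d * δ) y (x + δ) := by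
  obtain ⟨τ, a, b, h, hc⟩ := h
  have hσ' : IsRequestSeq K (σ ++ τ.map (· ∪ E)) := isRequestSeq_append_map_union hσ h.req hE
  have hE' : k + ({b} ∪ E).card ≤ K := by
    have := Finset.card_union_le {b} E
    rw [Finset.card_singleton] at this
    omega
  -- With `b` in the padding, a crossing counts as an escape; with `b` and `F` among the remembered
  -- points, distances from `q` stay additive.
  obtain ⟨υ, q, hυ, hr, hq, hqB, hfin⟩ := hB _ ({b} ∪ E) (insert a (insert b F)) hσ' hE'
    (by simp [h.pos_eq])
  rw [h.pos_eq] at hr hq hqB hfin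
  have hbp : dist b (A.pos s₀ σ) = y := by simpa using h.dist_right _ hF
  have hlist : σ ++ τ.map (· ∪ E) ++ υ.map (· ∪ ({b} ∪ E)) =
      σ ++ (τ ++ υ.map (· ∪ {b})).map (· ∪ E) := by
    simp [Function.comp_def]
  rw [hlist] at hfin
  have hreq : IsRequestSeq (k + 1) (τ ++ υ.map (· ∪ {b})) :=
    isRequestSeq_append_map_union h.req hυ (by simp)
  have hrb : OfflineReach (A.pos s₀ σ) (τ ++ υ.map (· ∪ {b})) b y := by
    simpa using h.reach_right.append (.stay (τ := υ.map (· ∪ {b})) (by simp))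
  have hrq : OfflineReach (A.pos s₀ σ) (τ ++ υ.map (· ∪ {b})) q (x + dist q a) :=
    h.reach_left.append (hr.map_mono _ fun _ => Finset.subset_union_left)
  have hqF : ∀ z ∈ F, dist q z = x + dist q a + dist (A.pos s₀ σ) z := fun z hz => by
    rw [hq z (by simp [hz]), h.dist_left z hz]
    ring
  have hqb : dist q b = x + dist q a + y := by
    rw [hq b (by simp), h.dist_eq]
    ring
  rcases hfin with hfin | ⟨h1, h2, h3⟩
  · rcases Finset.mem_union.1 hfin with hb | hE
    · rw [Finset.mem_singleton] at hb
      -- The crossing pays `x + y`, while the abandoned branch may still be extended by `dist q a`,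
      -- which costs `d * dist q a` of excess.
      refine Or.inr (Or.inr ⟨dist q a, dist_nonneg, hqB, _, b, q,
        ⟨hreq, hb, h.dist_right, hqF, ?_, hrb, hrq⟩, ?_⟩)
      · rw [dist_comm, hqb]
        ring
      · have hc' := dist_le_cost A s₀ (σ ++ τ.map (· ∪ E)) ((υ.map (· ∪ {b})).map (· ∪ E))
        rw [List.append_assoc, ← List.map_append, hb, h.pos_eq, h.dist_eq] at hc'
        linarith
    · exact Or.inl ⟨_, b, hreq, by rwa [hbp], by rw [hbp]; exact h.dist_right,
        hbp.trans_le hy, Or.inl hE⟩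
  · exact Or.inr (Or.inl ⟨dist q a, h2, _, q, b,
      ⟨hreq, h1, hqF, h.dist_right, hqb, hrq, hrb⟩, by linarith⟩)

end Branches

/-! ### The search on two branches -/

/-- The rules of the search on two branches. `P Z x y` says that the searcher is at depth `x` of
one branch, that the other one has depth `y`, and that the cost so far exceeds `d * (x + y)` by
`Z`; `W` says that the adversary has won. -/
structure IsSearch (α β d L B B' : ℝ) (P : ℝ → ℝ → ℝ → Prop) (W : Prop) : Prop where
  win : ∀ {Z x y}, P Z x y → β * y ≤ Z + α * x → L ≤ y → y ≤ B' → W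
  step : ∀ {Z x y}, P Z x y → y ≤ B' → W ∨ (∃ δ, 1 ≤ δ ∧ P Z (x + δ) y) ∨
    ∃ δ, 0 ≤ δ ∧ δ ≤ B ∧ P (Z + x + y - d * δ) y (x + δ)

namespace IsSearch

variable {α β d L B B' : ℝ} {P : ℝ → ℝ → ℝ → Prop} {W : Prop}

/-- The searcher has to turn before the adversary can win by cutting off its branch. -/
theorem turn (h : IsSearch α β d L B B' P W) (hα : 0 < α) {Z x y : ℝ} (hP : P Z x y)
    (hL : L ≤ y) (hy : y ≤ B') :
    W ∨ ∃ x' δ, x ≤ x' ∧ Z + α * x' < β * y ∧ 0 ≤ δ ∧ δ ≤ B ∧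
      P (Z + x' + y - d * δ) y (x' + δ) := by
  -- Each advance has length at least 1 and keeps `Z`, so `n` bounds the number of advances.
  obtain ⟨n, hn⟩ := exists_nat_ge ((β * y - Z) / α - x)
  induction n generalizing x with
  | zero =>
    left
    refine h.win hP ?_ hL hy
    rw [Nat.cast_zero, sub_nonpos, div_le_iff₀ hα] at hn
    linarith
  | succ n ih =>
    by_cases hlt : Z + α * x < β * y
    · rcases h.step hP hy with hW | ⟨δ, h1, hP'⟩ | ⟨δ, h0, h1, hP'⟩
      · exact Or.inl hW
      · rcases ih hP' (by push_cast at hn; linarith) with hW | ⟨x', δ', h2, h3⟩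
        · exact Or.inl hW
        · exact Or.inr ⟨x', δ', by linarith, h3⟩
      · exact Or.inr ⟨x, δ, le_rfl, hlt, h0, h1, hP'⟩
    · exact Or.inl (h.win hP (not_lt.1 hlt) hL hy)

/-- Without `δ`, the gain in `u` is at least `κ / (β + 1 - u) ≥ κ / β = 2 * c`, by `hquad` and the
failed win `hlt`. Half of it absorbs `δ ≤ B`, because `L` is large compared with `B`. -/
theorem late_turn_bound {c κ u Z x y δ : ℝ} (hd : 0 ≤ d) (hα : 0 < α) (hc : 0 < c)
    (hL0 : 0 < L) (hβ : 0 < β) (hκ : κ = 2 * β * c)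
    (hquad : ∀ u : ℝ, κ ≤ u ^ 2 - (β + 3 - α) * u + 2 * (β + 1))
    (hLB : (β + 1 + c + d) * B ≤ c * L) (hu : 1 ≤ u) (hx : L ≤ x)
    (hZ : u * y ≤ Z + y) (hlt : Z + α * x < β * y) (hy : 0 < y) (hδ0 : 0 ≤ δ) (hδ : δ ≤ B) :
    (u + c) * (x + δ) ≤ (Z + x + y - d * δ) + (x + δ) := by
  have hx0 : 0 < x := hL0.trans_le hx
  have hvy : α * x < (β + 1 - u) * y := by linarith
  have hv : 0 < β + 1 - u := by
    have : 0 < (β + 1 - u) * y := (mul_pos hα hx0).trans hvy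
    exact pos_of_mul_pos_left this hy.le
  have hmain : 2 * c * x ≤ u * y + 2 * x - u * x := by
    have h1 : 2 * c * x * (β + 1 - u) ≤ κ * x := by
      rw [hκ]
      have : 2 * c * x * (β + 1 - u) ≤ 2 * c * x * β := by
        apply mul_le_mul_of_nonneg_left (by linarith) (by positivity)
      linarith
    have h2 : κ * x ≤ (u ^ 2 - (β + 3 - α) * u + 2 * (β + 1)) * x :=
      mul_le_mul_of_nonneg_right (hquad u) hx0.le
    have h3 : u * (α * x) ≤ u * ((β + 1 - u) * y) :=
      mul_le_mul_of_nonneg_left hvy.le (by linarith)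
    refine le_of_mul_le_mul_right ?_ hv
    linarith
  have h4 : (u + c + d) * δ ≤ c * x := by
    calc (u + c + d) * δ ≤ (β + 1 + c + d) * B := by
          apply mul_le_mul (by linarith) hδ hδ0 (by linarith)
      _ ≤ c * L := hLB
      _ ≤ c * x := by gcongr
  linarith

/-- The late phase of the search, where `Z` is nonnegative. -/
theorem late (hd : 0 ≤ d) (hα : 0 < α) (hβ : 0 < β) {c κ : ℝ} (hc : 0 < c) (hL0 : 0 < L)
    (hκ : κ = 2 * β * c) (hquad : ∀ u : ℝ, κ ≤ u ^ 2 - (β + 3 - α) * u + 2 * (β + 1))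
    (hLB : (β + 1 + c + d) * B ≤ c * L) (n : ℕ) :
    ∀ Y : ℝ, ∃ B₀, ∀ B' ≥ B₀, ∀ P W, IsSearch α β d L B B' P W → ∀ u Z x y, 1 ≤ u →
      β + 1 - n * c ≤ u → u * y ≤ Z + y → L ≤ x → L ≤ y → y ≤ Y → P Z x y → W := by
  induction n with
  | zero =>
    refine fun Y => ⟨Y, fun B' hB' P W h u Z x y hu hn hZ hx hy hY hP => ?_⟩
    refine h.win hP ?_ hy (hY.trans hB')
    have h1 : (β + 1) * y ≤ u * y := by
      apply mul_le_mul_of_nonneg_right (by simpa using hn) (by linarith)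
    have h2 : 0 ≤ α * x := mul_nonneg hα.le (by linarith)
    linarith
  | succ n ih =>
    intro Y
    -- As `Z ≥ 0`, the failed win gives `α * x' < β * y`, which bounds the depth after the turn
    -- independently of the algorithm.
    obtain ⟨B₀, hB₀⟩ := ih (β * Y / α + B)
    refine ⟨max B₀ Y, fun B' hB' P W h u Z x y hu hn hZ hx hy hY hP => ?_⟩
    have hy0 : 0 < y := hL0.trans_le hy
    rcases h.turn hα hP hy (hY.trans ((le_max_right _ _).trans hB')) with
      hW | ⟨x', δ, hxx', hlt, hδ0, hδ, hP'⟩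
    · exact hW
    · refine hB₀ B' ((le_max_left _ _).trans hB') P W h (u + c) _ _ _ (by linarith)
        (by push_cast at hn; linarith)
        (late_turn_bound hd hα hc hL0 hβ hκ hquad hLB hu (hx.trans hxx') hZ hlt hy0 hδ0 hδ)
        hy (by linarith) ?_ hP'
      have h1 : y ≤ u * y := le_mul_of_one_le_left hy0.le hu
      have h2 : β * y ≤ β * Y := by gcongr
      have h3 : x' ≤ β * Y / α := by
        rw [le_div_iff₀ hα]
        linarith
      linarith

/-- The early phase of the search, where `Z` may be negative, followed by the late one. -/
theorem early (hd : 0 ≤ d) (hα : 0 < α) (hβ : 0 < β) {c κ : ℝ} (hc : 0 < c) (hL0 : 0 < L)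
    (hκ : κ = 2 * β * c) (hquad : ∀ u : ℝ, κ ≤ u ^ 2 - (β + 3 - α) * u + 2 * (β + 1))
    (hLB : (β + 1 + c + d) * B ≤ c * L) (hLB' : d * B ≤ L) (n : ℕ) :
    ∀ Y : ℝ, ∃ B₀, ∀ B' ≥ B₀, ∀ P W, IsSearch α β d L B B' P W → ∀ Z x y,
      -(n * L) ≤ Z → L ≤ x → L ≤ y → y ≤ Y → P Z x y → W := by
  induction n with
  | zero =>
    intro Y
    obtain ⟨m, hm⟩ := exists_nat_ge (β / c)
    rw [div_le_iff₀ hc] at hm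
    obtain ⟨B₀, hB₀⟩ := late hd hα hβ hc hL0 hκ hquad hLB m Y
    refine ⟨B₀, fun B' hB' P W h Z x y hZ hx hy hY hP => ?_⟩
    have hZ' : 0 ≤ Z := by simpa using hZ
    exact hB₀ B' hB' P W h 1 Z x y le_rfl (by linarith) (by linarith) hx hy hY hP
  | succ n ih =>
    intro Y
    obtain ⟨B₀, hB₀⟩ := ih ((β * Y + (n + 1) * L) / α + B)
    refine ⟨max B₀ Y, fun B' hB' P W h Z x y hZ hx hy hY hP => ?_⟩
    push_cast at hZ
    rcases h.turn hα hP hy (hY.trans ((le_max_right _ _).trans hB')) with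
      hW | ⟨x', δ, hxx', hlt, hδ0, hδ, hP'⟩
    · exact hW
    · refine hB₀ B' ((le_max_left _ _).trans hB') P W h _ _ _ ?_ hy (by linarith) ?_ hP'
      -- Each turn raises `Z` by at least `2 * L - d * B ≥ L`.
      · have : d * δ ≤ d * B := by gcongr
        linarith
      · have h2 : β * y ≤ β * Y := by gcongr
        have h3 : x' ≤ (β * Y + (n + 1) * L) / α := by
          rw [le_div_iff₀ hα]
          linarith
        linarith

/-- The adversary wins the search for every ratio `ρ < 2 * d + 3 + √(8 + 8 * d)`. -/
theorem exists_win {d ρ : ℝ} (hd : 0 ≤ d) (hρ : 2 * d + 3 ≤ ρ)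
    (hρ' : ρ < 2 * d + 3 + √(8 + 8 * d)) (B : ℝ) :
    ∃ L B₀ : ℝ, 1 ≤ L ∧ ∀ B' ≥ B₀, ∀ P W, IsSearch (d + 1) (ρ - d - 1) d L B B' P W →
      P (L - 2 * d * L) L L → W := by
  set β := ρ - d - 1 with hβdef
  have hβ : 0 < β := by linarith
  have hsq : (ρ - 2 * d - 3) ^ 2 < 8 + 8 * d := by
    have h1 : (ρ - 2 * d - 3) ^ 2 < √(8 + 8 * d) ^ 2 :=
      pow_lt_pow_left₀ (by linarith) (by linarith) two_ne_zero
    rwa [Real.sq_sqrt (by linarith)] at h1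
  -- The minimum of the quadratic in `hquad`, that is, its discriminant divided by `-4`.
  set κ : ℝ := (8 + 8 * d - (ρ - 2 * d - 3) ^ 2) / 4 with hκdef
  have hκ : 0 < κ := by
    rw [hκdef]
    linarith
  have hquad : ∀ u : ℝ, κ ≤ u ^ 2 - (β + 3 - (d + 1)) * u + 2 * (β + 1) := fun u => by
    have := sq_nonneg (u - (β + 3 - (d + 1)) / 2)
    rw [hκdef, hβdef] at *
    linarith
  set c : ℝ := κ / (2 * β) with hcdef
  have hc : 0 < c := by positivity
  have hκc : κ = 2 * β * c := by
    rw [hcdef]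
    field_simp
  obtain ⟨n, hn⟩ := exists_nat_ge (2 * d)
  set L : ℝ := max 1 (max ((β + 1 + c + d) * B / c) (d * B)) with hLdef
  have hL1 : 1 ≤ L := le_max_left _ _
  have hLB : (β + 1 + c + d) * B ≤ c * L := by
    have : (β + 1 + c + d) * B / c ≤ L := (le_max_left _ _).trans (le_max_right _ _)
    rw [div_le_iff₀ hc] at this
    linarith
  have hLB' : d * B ≤ L := (le_max_right _ _).trans (le_max_right _ _)
  obtain ⟨B₀, hB₀⟩ := early hd (by linarith : 0 < d + 1) hβ hc (by linarith) hκc hquad hLB hLB' n L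
  refine ⟨L, B₀, hL1, fun B' hB' P W h hP => ?_⟩
  refine hB₀ B' hB' P W h _ L L ?_ le_rfl le_rfl le_rfl hP
  have : 2 * d * L ≤ n * L := by gcongr
  linarith

end IsSearch

/-! ### The recursion for the forced ratio -/

theorem IsForced.succ {k : ℕ} (hk : 1 ≤ k) {d ρ : ℝ} (hd : 0 ≤ d) (h : IsForced.{u} k d)
    (hρ : 2 * d + 3 ≤ ρ) (hρ' : ρ < 2 * d + 3 + √(8 + 8 * d)) : IsForced.{u} (k + 1) ρ := by
  obtain ⟨B, hB⟩ := h
  obtain ⟨L, B₀, hL, hwin⟩ := IsSearch.exists_win hd hρ hρ' B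
  refine ⟨max B₀ L, fun K A M _ _ hM s₀ σ E F hσ hE hF => ?_⟩
  rcases forces_or_reached_init hM hσ (by omega) hE hF (zero_le_one.trans hL)
    (le_max_right B₀ L) d ρ with hW | hP
  · exact hW
  · exact hwin _ (le_max_left _ _) (Reached A s₀ (k + 1) σ E F d) _
      { win := fun h hZ hy hyB => h.forces hσ (by omega) hE hF hZ (hL.trans hy) hyB
        step := fun h hy => h.step (hB K A M hM s₀) hσ hE hF hy } hP

theorem one_le_D_succ (k : ℕ) : 1 ≤ D (k + 1) := by
  induction k with
  | zero => exact le_rfl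
  | succ k ih =>
    have := Real.sqrt_nonneg (8 + 8 * D (k + 1))
    change 1 ≤ 2 * D (k + 1) + √(8 + 8 * D (k + 1)) + 3
    linarith

theorem isForced_of_lt_D (k : ℕ) : ∀ ρ < D (k + 1), IsForced.{u} (k + 1) ρ := by
  induction k with
  | zero => exact fun ρ hρ => isForced_one.mono hρ.le
  | succ k ih =>
    intro ρ hρ
    have hD := one_le_D_succ k
    have hs : 0 < √(8 + 8 * D (k + 1)) := Real.sqrt_pos.2 (by linarith)
    -- Raising `ρ` secures `2 * d + 3 ≤ ρ`, which the squaring in `exists_win` needs.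
    refine IsForced.mono (ρ := max ρ (2 * D (k + 1) + 3)) ?_ (le_max_left _ _)
    have hlt : max ρ (2 * D (k + 1) + 3) < 2 * D (k + 1) + 3 + √(8 + 8 * D (k + 1)) := by
      refine max_lt (hρ.trans_eq ?_) (by linarith)
      change 2 * D (k + 1) + √(8 + 8 * D (k + 1)) + 3 = _
      ring
    -- Only ratios strictly below `D (k + 1)` are available; by continuity some such `d` still
    -- suffices.
    have hcont : Continuous fun d : ℝ => 2 * d + 3 + √(8 + 8 * d) := by fun_prop
    have hev := hcont.continuousAt.eventually_const_lt hlt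
    obtain ⟨d, ⟨hd1, hd0⟩, hd⟩ := ((hev.and (lt_mem_nhds (by linarith : 0 < D (k + 1)))).filter_mono
      nhdsWithin_le_nhds |>.and (self_mem_nhdsWithin (s := Set.Iio (D (k + 1))))).exists
    exact (ih d hd).succ (by omega) hd0.le
      ((by linarith : 2 * d + 3 ≤ 2 * D (k + 1) + 3).trans (le_max_right _ _)) hd1

/-! ### A space with free directions -/

namespace FinsuppL1

/-- The `ℓ¹` norm of a finitely supported sequence. -/
noncomputable def absSum (f : ULift.{u} ℕ →₀ ℝ) : ℝ := f.sum fun _ t => |t|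

theorem absSum_add_le (f g : ULift.{u} ℕ →₀ ℝ) : absSum (f + g) ≤ absSum f + absSum g := by
  classical
  have hf : absSum f = ∑ i ∈ f.support ∪ g.support, |f i| :=
    Finsupp.sum_of_support_subset _ Finset.subset_union_left _ (by simp)
  have hg : absSum g = ∑ i ∈ f.support ∪ g.support, |g i| :=
    Finsupp.sum_of_support_subset _ Finset.subset_union_right _ (by simp)
  have hfg : absSum (f + g) = ∑ i ∈ f.support ∪ g.support, |(f + g) i| :=
    Finsupp.sum_of_support_subset _ Finsupp.support_add _ (by simp)
  rw [hf, hg, hfg, ← Finset.sum_add_distrib]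
  exact Finset.sum_le_sum fun i _ => abs_add_le _ _

theorem absSum_neg (f : ULift.{u} ℕ →₀ ℝ) : absSum (-f) = absSum f := by
  simp [absSum, Finsupp.sum_neg_index]

theorem eq_zero_of_absSum_eq_zero {f : ULift.{u} ℕ →₀ ℝ} (h : absSum f = 0) : f = 0 := by
  ext i
  by_contra hi
  have := (Finset.sum_eq_zero_iff_of_nonneg fun j _ => abs_nonneg (f j)).1 h i
    (Finsupp.mem_support_iff.2 hi)
  exact hi (abs_eq_zero.1 this)

theorem absSum_single_add {f : ULift.{u} ℕ →₀ ℝ} {i : ULift.{u} ℕ} (hi : f i = 0) {L : ℝ}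
    (hL : 0 ≤ L) : absSum (Finsupp.single i L + f) = L + absSum f := by
  classical
  unfold absSum
  rw [Finsupp.sum_add_index_of_disjoint, Finsupp.sum_single_index (by simp), abs_of_nonneg hL]
  refine Finset.disjoint_left.2 fun j hj hj' => ?_
  rw [Finset.mem_singleton.1 (Finsupp.support_single_subset hj)] at hj'
  exact Finsupp.mem_support_iff.1 hj' hi

/-- The `ℓ¹` distance of finitely supported sequences. -/
noncomputable instance metricSpace : MetricSpace (ULift.{u} ℕ →₀ ℝ) where
  dist f g := absSum (f - g)
  dist_self f := by
    rw [sub_self]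
    exact Finsupp.sum_zero_index
  dist_comm f g := by rw [← absSum_neg, neg_sub]
  dist_triangle f g h := by
    rw [← sub_add_sub_cancel f g h]
    exact absSum_add_le _ _
  eq_of_dist_eq_zero h := sub_eq_zero.1 (eq_zero_of_absSum_eq_zero h)

/-- A coordinate outside all the supports is free: in `ℓ¹`, moving along it adds its full length to
every distance. -/
theorem hasFreeDirections : HasFreeDirections (ULift.{u} ℕ →₀ ℝ) := by
  classical
  intro F p L hL
  obtain ⟨i, hi⟩ := Infinite.exists_notMem_finset (p.support ∪ F.biUnion Finsupp.support)
  rw [Finset.mem_union, not_or, Finset.mem_biUnion, not_exists] at hi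
  refine ⟨Finsupp.single i L + p, fun z hz => ?_⟩
  change absSum (Finsupp.single i L + p - z) = L + absSum (p - z)
  have hp : p i = 0 := Finsupp.notMem_support_iff.1 hi.1
  have hz' : z i = 0 := Finsupp.notMem_support_iff.1 fun h => hi.2 z ⟨hz, h⟩
  rw [add_sub_assoc, absSum_single_add _ hL]
  rw [Finsupp.sub_apply, hp, hz', sub_zero]

end FinsuppL1

end SmallSetChasing

/-! ### The lower bound -/

theorem theorem3 (k : ℕ) (hk : 1 ≤ k) (A : SmallSetChasing.OnlineAlgorithm.{u} k)
    (ρ : ℝ) (hρ : A.IsCompetitive ρ) : SmallSetChasing.D k ≤ ρ := by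
  classical
  obtain ⟨k, rfl⟩ := Nat.exists_eq_add_of_le' hk
  by_contra! hlt
  -- A negative `ρ` is not excluded; `max ρ 0` can multiply the bound on the optimum.
  obtain ⟨ρ', h1, h2⟩ := exists_between
    (max_lt hlt (zero_lt_one.trans_le (SmallSetChasing.one_le_D_succ k)))
  obtain ⟨B, hB⟩ := SmallSetChasing.isForced_of_lt_D.{u} k ρ' h2
  let s₀ : ULift.{u} ℕ →₀ ℝ := 0
  obtain ⟨τ, q, hτ, hr, -, -, h⟩ := hB _ A _ SmallSetChasing.FinsuppL1.hasFreeDirections s₀ [] ∅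
    {s₀} (by simp [SmallSetChasing.IsRequestSeq]) (by simp) (by simp [A.pos_nil])
  have hmap : [] ++ τ.map (· ∪ ∅) = τ := by simp
  rw [hmap, A.pos_nil] at h
  rw [A.pos_nil] at hr
  rcases h with h | ⟨-, hd, hc⟩
  -- The padding is empty, so there is no escape.
  · simp at h
  · have hcost : A.cost s₀ [] = 0 := by simp [SmallSetChasing.OnlineAlgorithm.cost]
    obtain ⟨x, -, -, hx⟩ := (SmallSetChasing.isLeast_offlineOpt s₀ τ hτ).1
    have hopt : 0 ≤ SmallSetChasing.offlineOpt s₀ τ := by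
      rw [hx]
      exact Finset.sum_nonneg fun _ _ => dist_nonneg
    have hlt' : max ρ 0 * dist q s₀ < ρ' * dist q s₀ := mul_lt_mul_of_pos_right h1 (by linarith)
    have h3 := mul_le_mul_of_nonneg_right (le_max_left ρ 0) hopt
    have h4 := mul_le_mul_of_nonneg_left hr.offlineOpt_le (le_max_right ρ 0)
    linarith [hρ _ s₀ τ hτ]
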